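/- Let $a,d\in\mathbb N$ and let $X_{ik}=(X_{ijk})_{j=1}^d$, $i=1,\dots,a$, $k=1,2,\dots$, be independent $\mathbb R^d$-valued random vectors on a probability space, identically distributed within each group $i$. Let $F_{ij}$ be the normalized distribution function of $X_{ij1}$, i.e. $F_{ij}(x)=\tfrac12\big(P(X_{ij1}<x)+P(X_{ij1}\le x)\big)$; write $\int\cdot\,dF_{ij}$ for integration with respect to the law of $X_{ij1}$, put $G_j=\frac1a\sum_{i=1}^aF_{ij}$, and let $p=(p_{ij})_{i\le a,\,j\le d}$ with $$p_{ij}=\int G_j\,dF_{ij}.$$ For sample sizes $n_1,\dots,n_a$ with $N=\sum_{i=1}^a n_i$, let $\widehat F_{ij}(x)=\frac1{n_i}\sum_{k=1}^{n_i}c(x-X_{ijk})$, where $c(u)=\mathbf 1\{u>0\}+\frac12\mathbf 1\{u=0\}$, let $\widehat G_j=\frac1a\sum_{i=1}^a\widehat F_{ij}$, and let $\widehat p=(\widehat p_{ij})$ with $$\widehat p_{ij}=\int\widehat G_j\,d\widehat F_{ij}=\frac1a\sum_{\ell=1}^a\frac1{n_\ell n_i}\sum_{k=1}^{n_i}\sum_{r=1}^{n_\ell}c(X_{ijk}-X_{\ell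 jr}).$$ Suppose that, as $N\to\infty$, $n_i/N\to\lambda_i\in(0,1)$ for every $i=1,\dots,a$. Then $$\sqrt N\,(\widehat p-p)\ \xrightarrow{\ d\ }\ N_{ad}(0,\Sigma)\qquad(N\to\infty),$$ where the positive semidefinite matrix $\Sigma\in\mathbb R^{ad\times ad}$ is given as follows. Let $w_{\ell ij}=\int F_{\ell j}\,dF_{ij}$, $\tau_{ii'\ell j}=\int F_{ij}F_{i'j}\,dF_{\ell j}$ and, for $j\neq j'$, $\rho_{ii'\ell jj'}=\int F_{ij}(u)F_{i'j'}(v)\,dF_{\ell jj'}(u,v)$, with $F_{\ell jj'}$ the joint distribution of $(X_{\ell j1},X_{\ell j'1})$. Let $$\kappa^{(\ell)}_{ij,i'j'}=\operatorname{cov}\big(F_{ij}(X_{\ell j1}),F_{i'j'}(X_{\ell j'1})\big)=\begin{cases}\tau_{ii'\ell j}-w_{i\ell j}w_{i'\ell j}, & j=j',\\ \rho_{ii'\ell jj'}-w_{i\ell j}w_{i'\ell j'}, & j\ne j',\end{cases}$$ and let $\Sigma_{\ell\ell'}$ be the $ad\times ad$ matrix whose entry at $\big((i,j),(i',j')\big)$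 is $$\delta_{\ell\ell'}\frac N{n_\ell}\kappa^{(\ell)}_{ij,i'j'}-\delta_{\ell i'}\frac N{n_\ell}\kappa^{(\ell)}_{ij,\ell'j'}+\delta_{ii'}\frac N{n_i}\kappa^{(i)}_{\ell j,\ell'j'}-\delta_{i\ell'}\frac N{n_i}\kappa^{(i)}_{\ell j,i'j'},$$ where $\delta$ is Kronecker's delta. Then $$\Sigma=\lim_{N\to\infty}\frac1{a^2}\sum_{\ell=1}^a\sum_{\ell'=1}^a\Sigma_{\ell\ell'},$$ i.e. the same expression with each $N/n_i$ replaced by $1/\lambda_i$. -/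

import Mathlib

open MeasureTheory ProbabilityTheory Filter Topology
open scoped ENNReal

namespace MannWhitney

noncomputable section

/-- The normalized distribution function of a distribution `μ` on `ℝ`: the mean of its
left-continuous version `x ↦ μ (-∞, x)` and its right-continuous version `x ↦ μ (-∞, x]`. -/
def normCDF (μ : Measure ℝ) (x : ℝ) : ℝ :=
  (μ.real (Set.Iio x) + μ.real (Set.Iic x)) / 2

section Model

variable {a d : ℕ}

/-- The `j`-th marginal of the distribution `Q i` of the observation vectors in group `i`. -/
def marginal (Q : Fin a → Measure (Fin d → ℝ)) (i : Fin a) (j : Fin d) : Measure ℝ :=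
  (Q i).map (fun x => x j)

/-- `F_ij`, the normalized distribution function of the `j`-th component in group `i`. -/
def F (Q : Fin a → Measure (Fin d → ℝ)) (i : Fin a) (j : Fin d) : ℝ → ℝ :=
  normCDF (marginal Q i j)

/-- `G_j = (1/a) ∑_i F_ij`, the unweighted mean distribution function. -/
def G (Q : Fin a → Measure (Fin d → ℝ)) (j : Fin d) (x : ℝ) : ℝ :=
  (1 / (a : ℝ)) * ∑ i, F Q i j x

/-- The effect `p_ij = ∫ G_j dF_ij`. -/
def p (Q : Fin a → Measure (Fin d → ℝ)) (i : Fin a) (j : Fin d) : ℝ :=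
  ∫ x, G Q j x ∂(marginal Q i j)

/-- The pairwise Mann-Whitney effect `w_ℓij = ∫ F_ℓj dF_ij`. -/
def w (Q : Fin a → Measure (Fin d → ℝ)) (l i : Fin a) (j : Fin d) : ℝ :=
  ∫ x, F Q l j x ∂(marginal Q i j)

/-- `τ_{ii'ℓj} = ∫ F_ij F_i'j dF_ℓj`. -/
def tau (Q : Fin a → Measure (Fin d → ℝ)) (i i' l : Fin a) (j : Fin d) : ℝ :=
  ∫ u, F Q i j u * F Q i' j u ∂(marginal Q l j)

/-- `ρ_{ii'ℓjj'} = ∫ F_ij(u) F_i'j'(v) dF_ℓjj'(u, v)`, where `F_ℓjj'` is the joint distribution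
of the components `j` and `j'` in group `ℓ`. -/
def rho (Q : Fin a → Measure (Fin d → ℝ)) (i i' l : Fin a) (j j' : Fin d) : ℝ :=
  ∫ z, F Q i j z.1 * F Q i' j' z.2 ∂((Q l).map (fun x => (x j, x j')))

/-- The covariance of `F_ij(X_ℓj1)` and `F_i'j'(X_ℓj'1)`. -/
def groupCov (Q : Fin a → Measure (Fin d → ℝ)) (l i : Fin a) (j : Fin d) (i' : Fin a)
    (j' : Fin d) : ℝ :=
  if j = j' then tau Q i i' l j - w Q i l j * w Q i' l j
  else rho Q i i' l j j' - w Q i l j * w Q i' l j'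

/-- The block `Σ_ℓℓ'` of the covariance matrix of the pairwise effects: its entry at
`((i, j), (i', j'))` belongs to the effects `(ℓ, i, j)` and `(ℓ', i', j')`. The argument `r i`
is the inverse of the proportion of group `i` in the total sample. -/
def SigmaBlock (Q : Fin a → Measure (Fin d → ℝ)) (r : Fin a → ℝ) (l l' : Fin a) :
    Matrix (Fin a × Fin d) (Fin a × Fin d) ℝ :=
  Matrix.of fun q q' =>
    (if l = l' then r l * groupCov Q l q.1 q.2 q'.1 q'.2 else 0)
    - (if l = q'.1 then r l * groupCov Q l q.1 q.2 l' q'.2 else 0)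
    + (if q.1 = q'.1 then r q.1 * groupCov Q q.1 l q.2 l' q'.2 else 0)
    - (if q.1 = l' then r q.1 * groupCov Q q.1 l q.2 q'.1 q'.2 else 0)

/-- The covariance matrix `(1/a²) ∑_ℓ ∑_ℓ' Σ_ℓℓ'`. -/
def Sigma (Q : Fin a → Measure (Fin d → ℝ)) (r : Fin a → ℝ) :
    Matrix (Fin a × Fin d) (Fin a × Fin d) ℝ :=
  (1 / (a : ℝ) ^ 2) • ∑ l, ∑ l', SigmaBlock Q r l l'

end Model

/-- `c(u) = 1{u > 0} + (1/2) 1{u = 0}`. -/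
def c (u : ℝ) : ℝ :=
  (if 0 < u then 1 else 0) + (1 / 2) * (if u = 0 then 1 else 0)

section Sample

variable {a d : ℕ}

/- A data set is given as `x i k j`, the `j`-th measurement of individual `k` in group `i`; the
individuals of group `i` are numbered `0, …, n i - 1`. -/

/-- The empirical normalized distribution function of the `j`-th component in group `i`. -/
def Fhat (n : Fin a → ℕ) (x : Fin a → ℕ → Fin d → ℝ) (i : Fin a) (j : Fin d) (t : ℝ) : ℝ :=
  (1 / (n i : ℝ)) * ∑ k ∈ Finset.range (n i), c (t - x i k j)

/-- The empirical distribution belonging to `Fhat n x i j`. -/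
def empMeasure (n : Fin a → ℕ) (x : Fin a → ℕ → Fin d → ℝ) (i : Fin a) (j : Fin d) :
    Measure ℝ :=
  (n i : ℝ≥0∞)⁻¹ • ∑ k ∈ Finset.range (n i), Measure.dirac (x i k j)

/-- The unweighted mean of the empirical distribution functions. -/
def Ghat (n : Fin a → ℕ) (x : Fin a → ℕ → Fin d → ℝ) (j : Fin d) (t : ℝ) : ℝ :=
  (1 / (a : ℝ)) * ∑ i, Fhat n x i j t

/-- The estimated effect `∫ Ĝ_j dF̂_ij`. -/
def phat (n : Fin a → ℕ) (x : Fin a → ℕ → Fin d → ℝ) (i : Fin a) (j : Fin d) : ℝ :=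
  ∫ t, Ghat n x j t ∂(empMeasure n x i j)

/-- The total sample size. -/
def total (n : Fin a → ℕ) : ℕ := ∑ i, n i

end Sample

end

end MannWhitney

namespace MannWhitney

/-! The estimator is an average of two-sample U-statistics, and the proof is a Hájek projection. For
each pair of groups, `what - w` equals the mean over group `i` of the centered `F_ℓj`, minus the
mean over group `ℓ` of the centered `F_ij`, plus `remainder`. For `ℓ ≠ i` the remainder averages a
kernel that integrates to zero in either argument (`integral_degKernel_left`,
`integral_degKernel_right`). Distinct summands are therefore orthogonal, the second moment is `O(1 /
(n_i n_ℓ))`, and `√N` times the remainder vanishes in `L¹` (`tendsto_integral_abs_remainder`). For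
`ℓ = i` it is exactly zero.

For a direction `t`, the projection is a sum of independent bounded centered scores, identically
distributed within each group (`sum_mul_phat_sub_p`). Its characteristic function is a product of
powers, each with a Gaussian limit by a second-order Taylor expansion (`tendsto_charFun_pow`). The
limiting variance is the quadratic form of `Sigma` at `t` by a finite-sum identity
(`sum_sigmaBlock_kernel`), which also gives positive semidefiniteness. Lévy's continuity theorem
concludes. -/

lemma c_nonneg (u : ℝ) : 0 ≤ c u := by
  unfold c; split_ifs <;> norm_num

lemma c_le_one (u : ℝ) : c u ≤ 1 := by
  unfold c; split_ifs <;> first | norm_num; done | linarith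

/-- The weight 1/2 at zero makes this hold for ties too, so no continuity of the distributions is
ever needed. -/
lemma c_add_c_neg (u : ℝ) : c u + c (-u) = 1 := by
  unfold c
  rcases lt_trichotomy u 0 with h | h | h
  · rw [if_neg (by linarith), if_neg h.ne, if_pos (by linarith), if_neg (by linarith)]; norm_num
  · simp [h]; norm_num
  · rw [if_pos h, if_neg h.ne', if_neg (by linarith), if_neg (by linarith)]; norm_num

@[fun_prop]
lemma measurable_c : Measurable c := by
  unfold c
  refine (Measurable.ite measurableSet_Ioi measurable_const measurable_const).add
    ((Measurable.ite (measurableSet_singleton 0) measurable_const measurable_const).const_mul _)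

/-- A bounded measurable function is integrable with respect to a finite measure. -/
lemma integrable_of_measurable_of_abs_le {α : Type*} [MeasurableSpace α] {μ : Measure α}
    [IsFiniteMeasure μ] {f : α → ℝ} (hf : AEMeasurable f μ) {C : ℝ} (hC : ∀ x, |f x| ≤ C) :
    Integrable f μ :=
  Integrable.of_bound hf.aestronglyMeasurable C (ae_of_all _ hC)

/-! ### Normalized distribution functions as averages of `c` -/

section NormCDF

variable (μ : Measure ℝ)

lemma normCDF_nonneg (x : ℝ) : 0 ≤ normCDF μ x := by
  unfold normCDF; positivity

lemma normCDF_le_one [IsProbabilityMeasure μ] (x : ℝ) : normCDF μ x ≤ 1 := by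
  unfold normCDF
  linarith [measureReal_le_one (μ := μ) (s := Set.Iio x),
    measureReal_le_one (μ := μ) (s := Set.Iic x)]

lemma abs_normCDF_le_one [IsProbabilityMeasure μ] (x : ℝ) : |normCDF μ x| ≤ 1 :=
  abs_le.2 ⟨by linarith [normCDF_nonneg μ x], normCDF_le_one μ x⟩

lemma monotone_normCDF [IsFiniteMeasure μ] : Monotone (normCDF μ) := by
  intro x y h
  unfold normCDF
  have h₁ := measureReal_mono (μ := μ) (Set.Iio_subset_Iio h)
  have h₂ := measureReal_mono (μ := μ) (Set.Iic_subset_Iic.2 h)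
  linarith

@[fun_prop]
lemma measurable_normCDF [IsFiniteMeasure μ] : Measurable (normCDF μ) :=
  (monotone_normCDF μ).measurable

lemma integral_c_sub_right [IsFiniteMeasure μ] (x : ℝ) : ∫ y, c (x - y) ∂μ = normCDF μ x := by
  have h : (fun y => c (x - y)) = fun y => ((Set.Iio x).indicator (fun _ => (1 : ℝ)) y
      + (Set.Iic x).indicator (fun _ => (1 : ℝ)) y) / 2 := by
    funext y
    unfold c
    rcases lt_trichotomy y x with h | h | h
    · rw [if_pos (by linarith), if_neg (by linarith), Set.indicator_of_mem (by exact h),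
        Set.indicator_of_mem (by exact h.le)]; norm_num
    · subst h; simp
    · rw [if_neg (by linarith), if_neg (by linarith), Set.indicator_of_notMem (by simp [h.le]),
        Set.indicator_of_notMem (by simp [h])]; norm_num
  rw [h, integral_div, integral_add, integral_indicator_const _ measurableSet_Iio,
    integral_indicator_const _ measurableSet_Iic, normCDF]
  · simp
  · exact (integrable_const _).indicator measurableSet_Iio
  · exact (integrable_const _).indicator measurableSet_Iic

lemma integrable_c_comp {α : Type*} [MeasurableSpace α] {ν : Measure α} [IsFiniteMeasure ν]
    {f : α → ℝ} (hf : AEMeasurable f ν) : Integrable (fun x => c (f x)) ν :=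
  integrable_of_measurable_of_abs_le (measurable_c.comp_aemeasurable hf)
    (fun x => abs_le.2 ⟨by linarith [c_nonneg (f x)], c_le_one _⟩)

lemma integral_c_sub_left [IsProbabilityMeasure μ] (y : ℝ) :
    ∫ x, c (x - y) ∂μ = 1 - normCDF μ y := by
  have h : ∀ x, c (x - y) = 1 - c (y - x) := fun x => by
    have := c_add_c_neg (x - y)
    rw [neg_sub] at this; linarith
  simp_rw [h]
  rw [integral_sub (integrable_const _) (integrable_c_comp (by fun_prop)), integral_c_sub_right]
  simp

/-- Fubini applied to `c (x - y)`, with `c_add_c_neg` for the exchange of the two arguments. -/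
lemma integral_normCDF_add_integral_normCDF (ν : Measure ℝ) [IsProbabilityMeasure μ]
    [IsProbabilityMeasure ν] : ∫ x, normCDF ν x ∂μ + ∫ y, normCDF μ y ∂ν = 1 := by
  have h₁ : ∫ x, normCDF ν x ∂μ = ∫ y, ∫ x, c (x - y) ∂μ ∂ν := by
    simp_rw [← integral_c_sub_right ν]
    exact integral_integral_swap (integrable_c_comp (by fun_prop))
  simp_rw [h₁, integral_c_sub_left μ]
  rw [integral_sub (integrable_const _)
    (integrable_of_measurable_of_abs_le (by fun_prop) (abs_normCDF_le_one μ))]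
  simp

end NormCDF

/-! ### Scores and their covariances -/

section Model

variable {a d : ℕ} (Q : Fin a → Measure (Fin d → ℝ))

instance [∀ i, IsProbabilityMeasure (Q i)] (i : Fin a) (j : Fin d) :
    IsProbabilityMeasure (marginal Q i j) :=
  Measure.isProbabilityMeasure_map (measurable_pi_apply j).aemeasurable

lemma integral_marginal (i : Fin a) (j : Fin d) {f : ℝ → ℝ} (hf : Measurable f) :
    ∫ x, f x ∂(marginal Q i j) = ∫ x, f (x j) ∂(Q i) :=
  integral_map (measurable_pi_apply j).aemeasurable hf.aestronglyMeasurable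

variable [∀ i, IsProbabilityMeasure (Q i)]

@[fun_prop]
lemma measurable_F (i : Fin a) (j : Fin d) : Measurable (F Q i j) :=
  measurable_normCDF _

lemma abs_F_le_one (i : Fin a) (j : Fin d) (x : ℝ) : |F Q i j x| ≤ 1 :=
  abs_normCDF_le_one _ x

lemma w_eq_integral (l i : Fin a) (j : Fin d) : w Q l i j = ∫ x, F Q l j (x j) ∂(Q i) :=
  integral_marginal Q i j (measurable_F Q l j)

lemma w_add_w (l i : Fin a) (j : Fin d) : w Q l i j + w Q i l j = 1 :=
  integral_normCDF_add_integral_normCDF _ _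

lemma abs_w_le_one (l i : Fin a) (j : Fin d) : |w Q l i j| ≤ 1 := by
  have h : ‖w Q l i j‖ ≤ 1 * (marginal Q i j).real Set.univ :=
    norm_integral_le_of_norm_le_const (ae_of_all _ fun x => abs_F_le_one Q l j x)
  simpa using h

lemma integrable_F_comp (l i : Fin a) (j : Fin d) :
    Integrable (fun x : Fin d → ℝ => F Q i j (x j)) (Q l) :=
  integrable_of_measurable_of_abs_le
    ((measurable_F Q i j).comp (measurable_pi_apply j)).aemeasurable
    (fun x => abs_F_le_one Q i j (x j))

lemma p_eq_sum (i : Fin a) (j : Fin d) : p Q i j = (1 / (a : ℝ)) * ∑ l, w Q l i j := by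
  unfold p G w
  rw [integral_const_mul, integral_finsetSum]
  exact fun l _ => integrable_of_measurable_of_abs_le (by fun_prop) (abs_F_le_one Q l j)

/-- Removes the case split on `j = j'`: both `tau` and `rho` are integrals of the same product
against `Q l`. -/
lemma groupCov_eq_integral (l i : Fin a) (j : Fin d) (i' : Fin a) (j' : Fin d) :
    groupCov Q l i j i' j' =
      ∫ x, (F Q i j (x j) - w Q i l j) * (F Q i' j' (x j') - w Q i' l j') ∂(Q l) := by
  have hprod : Integrable (fun x : Fin d → ℝ => F Q i j (x j) * F Q i' j' (x j')) (Q l) := by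
    refine integrable_of_measurable_of_abs_le (by fun_prop) (C := 1) (fun x => ?_)
    rw [abs_mul]
    exact mul_le_one₀ (abs_F_le_one ..) (abs_nonneg _) (abs_F_le_one ..)
  have hexp : ∀ x : Fin d → ℝ,
      (F Q i j (x j) - w Q i l j) * (F Q i' j' (x j') - w Q i' l j') =
      F Q i j (x j) * F Q i' j' (x j') - w Q i' l j' * F Q i j (x j)
        - w Q i l j * F Q i' j' (x j') + w Q i l j * w Q i' l j' := fun x => by ring
  have h : ∫ x, (F Q i j (x j) - w Q i l j) * (F Q i' j' (x j') - w Q i' l j') ∂(Q l)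
      = ∫ x, F Q i j (x j) * F Q i' j' (x j') ∂(Q l) - w Q i l j * w Q i' l j' := by
    simp_rw [hexp]
    have h₁ := (integrable_F_comp Q l i j).const_mul (w Q i' l j')
    have h₂ := (integrable_F_comp Q l i' j').const_mul (w Q i l j)
    have h₃ : Integrable (fun x : Fin d → ℝ => F Q i j (x j) * F Q i' j' (x j')
        - w Q i' l j' * F Q i j (x j)) (Q l) := hprod.sub h₁
    have h₄ : Integrable (fun x : Fin d → ℝ => F Q i j (x j) * F Q i' j' (x j')
        - w Q i' l j' * F Q i j (x j) - w Q i l j * F Q i' j' (x j')) (Q l) := h₃.sub h₂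
    rw [integral_add h₄ (integrable_const _), integral_sub h₃ h₂, integral_sub hprod h₁, integral_const_mul,
      integral_const_mul, ← w_eq_integral, ← w_eq_integral]
    simp
    ring
  rw [h, groupCov]
  split_ifs with hj
  · subst hj
    rw [tau, integral_marginal Q l j (f := fun u => F Q i j u * F Q i' j u) (by fun_prop)]
  · rw [rho, integral_map (by fun_prop) (Measurable.aestronglyMeasurable (by fun_prop))]

/-- The linear combination with coefficients `b` of the centered scores `F_ij(x_j)` of an
observation `x` in group `l`. -/
noncomputable def score (b : Fin a × Fin d → ℝ) (l : Fin a) (x : Fin d → ℝ) : ℝ :=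
  ∑ q, b q * (F Q q.1 q.2 (x q.2) - w Q q.1 l q.2)

@[fun_prop]
lemma measurable_score (b : Fin a × Fin d → ℝ) (l : Fin a) : Measurable (score Q b l) := by
  unfold score; fun_prop

lemma abs_F_sub_w_le (l i : Fin a) (j : Fin d) (x : ℝ) : |F Q i j x - w Q i l j| ≤ 2 :=
  (abs_sub _ _).trans (by linarith [abs_F_le_one Q i j x, abs_w_le_one Q i l j])

lemma abs_score_le (b : Fin a × Fin d → ℝ) (l : Fin a) (x : Fin d → ℝ) :
    |score Q b l x| ≤ ∑ q, |b q| * 2 := by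
  refine (Finset.abs_sum_le_sum_abs _ _).trans (Finset.sum_le_sum fun q _ => ?_)
  rw [abs_mul]
  exact mul_le_mul_of_nonneg_left (abs_F_sub_w_le ..) (abs_nonneg _)

lemma integral_score (b : Fin a × Fin d → ℝ) (l : Fin a) : ∫ x, score Q b l x ∂(Q l) = 0 := by
  unfold score
  rw [integral_finsetSum]
  · refine Finset.sum_eq_zero fun q _ => ?_
    rw [integral_const_mul, integral_sub (integrable_F_comp ..) (integrable_const _),
      ← w_eq_integral]
    simp
  · exact fun q _ => ((integrable_F_comp ..).sub (integrable_const _)).const_mul _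

lemma integral_score_sq (b : Fin a × Fin d → ℝ) (l : Fin a) :
    ∫ x, score Q b l x ^ 2 ∂(Q l) =
      ∑ q, ∑ q', b q * b q' * groupCov Q l q.1 q.2 q'.1 q'.2 := by
  have hint : ∀ q q' : Fin a × Fin d, Integrable (fun x : Fin d → ℝ => b q * b q' *
      ((F Q q.1 q.2 (x q.2) - w Q q.1 l q.2) * (F Q q'.1 q'.2 (x q'.2) - w Q q'.1 l q'.2)))
      (Q l) := fun q q' => by
    refine (integrable_of_measurable_of_abs_le (by fun_prop) (C := 2 * 2) fun x => ?_).const_mul _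
    rw [abs_mul]
    exact mul_le_mul (abs_F_sub_w_le ..) (abs_F_sub_w_le ..) (abs_nonneg _) (by norm_num)
  have hexp : ∀ x, score Q b l x ^ 2 = ∑ q, ∑ q', b q * b q' *
      ((F Q q.1 q.2 (x q.2) - w Q q.1 l q.2) * (F Q q'.1 q'.2 (x q'.2) - w Q q'.1 l q'.2)) := by
    intro x
    rw [score, sq, Finset.sum_mul_sum]
    exact Finset.sum_congr rfl fun q _ => Finset.sum_congr rfl fun q' _ => by ring
  simp_rw [hexp]
  rw [integral_finsetSum _ fun q _ => integrable_finsetSum _ fun q' _ => hint q q']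
  refine Finset.sum_congr rfl fun q _ => ?_
  rw [integral_finsetSum _ fun q' _ => hint q q']
  refine Finset.sum_congr rfl fun q' _ => ?_
  rw [integral_const_mul, groupCov_eq_integral]

end Model

/-! ### The quadratic form of `Sigma` -/

/-- Expanding `(s g - s i) * (s' g - s' i')` gives four products. Each Kronecker term on the left
collapses one summation and, after renaming the surviving indices, yields one of them (`hA` to
`hD`). -/
lemma sum_sigmaBlock_kernel {ι : Type*} [Fintype ι] [DecidableEq ι] (s s' r : ι → ℝ)
    (K : ι → ι → ι → ℝ) :
    ∑ i, ∑ i', s i * s' i' * ∑ l, ∑ l', ((if l = l' then r l * K l i i' else 0)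
      - (if l = i' then r l * K l i l' else 0) + (if i = i' then r i * K i l l' else 0)
      - (if i = l' then r i * K i l i' else 0)) =
    ∑ g, r g * ∑ i, ∑ i', (s g - s i) * (s' g - s' i') * K g i i' := by
  have hA : ∑ i, ∑ i', s i * s' i' * ∑ l, ∑ l', (if l = l' then r l * K l i i' else 0) =
      ∑ g, ∑ i, ∑ i', r g * (s i * s' i' * K g i i') := by
    simp only [Finset.sum_ite_eq, Finset.mem_univ, if_true, Finset.mul_sum]
    rw [Finset.sum_comm]
    conv_rhs => rw [Finset.sum_comm]; enter [2, i]; rw [Finset.sum_comm]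
    rw [Finset.sum_comm]
    exact Finset.sum_congr rfl fun i _ => Finset.sum_congr rfl fun i' _ =>
      Finset.sum_congr rfl fun l _ => by ring
  have hB : ∑ i, ∑ i', s i * s' i' * ∑ l, ∑ l', (if l = i' then r l * K l i l' else 0) =
      ∑ g, ∑ i, ∑ i', r g * (s i * s' g * K g i i') := by
    conv_lhs =>
      enter [2, i, 2, i']
      rw [Finset.sum_comm]
      simp only [Finset.sum_ite_eq', Finset.mem_univ, if_true, Finset.mul_sum]
    rw [Finset.sum_comm]
    exact Finset.sum_congr rfl fun i _ => Finset.sum_congr rfl fun i' _ =>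
      Finset.sum_congr rfl fun l _ => by ring
  have hC : ∑ i, ∑ i', s i * s' i' * ∑ l, ∑ l', (if i = i' then r i * K i l l' else 0) =
      ∑ g, ∑ i, ∑ i', r g * (s g * s' g * K g i i') := by
    refine Finset.sum_congr rfl fun i _ => ?_
    rw [Finset.sum_eq_single i (fun i' _ h => by simp [h.symm]) (by simp)]
    simp only [if_true, Finset.mul_sum]
    exact Finset.sum_congr rfl fun i' _ => Finset.sum_congr rfl fun l _ => by ring
  have hD : ∑ i, ∑ i', s i * s' i' * ∑ l, ∑ l', (if i = l' then r i * K i l i' else 0) =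
      ∑ g, ∑ i, ∑ i', r g * (s g * s' i' * K g i i') := by
    simp only [Finset.sum_ite_eq, Finset.mem_univ, if_true, Finset.mul_sum]
    refine Finset.sum_congr rfl fun i _ => ?_
    rw [Finset.sum_comm]
    exact Finset.sum_congr rfl fun i' _ => Finset.sum_congr rfl fun l _ => by ring
  simp only [Finset.sum_add_distrib, Finset.sum_sub_distrib, mul_add, mul_sub]
  rw [hA, hB, hC, hD]
  simp only [← Finset.sum_add_distrib, ← Finset.sum_sub_distrib, Finset.mul_sum]
  exact Finset.sum_congr rfl fun i _ => Finset.sum_congr rfl fun i' _ =>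
    Finset.sum_congr rfl fun l _ => by ring

lemma sum_sum_prod_eq {ι κ : Type*} [Fintype ι] [Fintype κ] (f : ι × κ → ι × κ → ℝ) :
    ∑ q, ∑ q', f q q' = ∑ j, ∑ j', ∑ i, ∑ i', f (i, j) (i', j') := by
  simp only [Fintype.sum_prod_type_right]
  exact Finset.sum_congr rfl fun j _ => Finset.sum_comm

section Model

variable {a d : ℕ} (Q : Fin a → Measure (Fin d → ℝ))

/-- The coefficients of the scores of group `g` in the projection of the linear combination of the
estimated effects with coefficients `t`. -/
noncomputable def projCoeff (t : Fin a × Fin d → ℝ) (g : Fin a) (q : Fin a × Fin d) : ℝ :=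
  (1 / (a : ℝ)) * (t (g, q.2) - t q)

lemma dotProduct_Sigma_mulVec (r : Fin a → ℝ) (t : Fin a × Fin d → ℝ) :
    t ⬝ᵥ (Sigma Q r).mulVec t = ∑ g, r g * ∑ q, ∑ q', projCoeff t g q * projCoeff t g q' *
      groupCov Q g q.1 q.2 q'.1 q'.2 := by
  have hl : t ⬝ᵥ (Sigma Q r).mulVec t = ∑ j, ∑ j', (1 / (a : ℝ) ^ 2) *
      ∑ i, ∑ i', t (i, j) * t (i', j') * ∑ l, ∑ l',
        ((if l = l' then r l * groupCov Q l i j i' j' else 0)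
        - (if l = i' then r l * groupCov Q l i j l' j' else 0)
        + (if i = i' then r i * groupCov Q i l j l' j' else 0)
        - (if i = l' then r i * groupCov Q i l j i' j' else 0)) := by
    have h : t ⬝ᵥ (Sigma Q r).mulVec t = ∑ q, ∑ q', t q * (Sigma Q r q q' * t q') :=
      Finset.sum_congr rfl fun q _ => Finset.mul_sum _ _ _
    rw [h, sum_sum_prod_eq]
    refine Finset.sum_congr rfl fun j _ => Finset.sum_congr rfl fun j' _ => ?_
    rw [Finset.mul_sum]
    refine Finset.sum_congr rfl fun i _ => ?_
    rw [Finset.mul_sum]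
    refine Finset.sum_congr rfl fun i' _ => ?_
    simp only [Sigma, Matrix.smul_apply, Matrix.sum_apply, SigmaBlock, Matrix.of_apply,
      smul_eq_mul]
    ring
  have hr : ∑ g, r g * ∑ q, ∑ q', projCoeff t g q * projCoeff t g q' *
      groupCov Q g q.1 q.2 q'.1 q'.2 = ∑ j, ∑ j', (1 / (a : ℝ) ^ 2) *
      ∑ g, r g * ∑ i, ∑ i', (t (g, j) - t (i, j)) * (t (g, j') - t (i', j')) *
        groupCov Q g i j i' j' := by
    have h : ∀ g, r g * ∑ q, ∑ q', projCoeff t g q * projCoeff t g q' *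
        groupCov Q g q.1 q.2 q'.1 q'.2 = ∑ j, ∑ j', (1 / (a : ℝ) ^ 2) *
        (r g * ∑ i, ∑ i', (t (g, j) - t (i, j)) * (t (g, j') - t (i', j')) *
        groupCov Q g i j i' j') := fun g => by
      rw [sum_sum_prod_eq]
      simp only [projCoeff, Finset.mul_sum]
      exact Finset.sum_congr rfl fun j _ => Finset.sum_congr rfl fun j' _ =>
        Finset.sum_congr rfl fun i _ => Finset.sum_congr rfl fun i' _ => by ring
    simp_rw [h]
    rw [Finset.sum_comm]
    refine Finset.sum_congr rfl fun j _ => ?_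
    rw [Finset.sum_comm]
    exact Finset.sum_congr rfl fun j' _ => (Finset.mul_sum _ _ _).symm
  rw [hl, hr]
  refine Finset.sum_congr rfl fun j _ => Finset.sum_congr rfl fun j' _ => ?_
  rw [sum_sigmaBlock_kernel (fun i => t (i, j)) (fun i => t (i, j')) r
    (fun g i i' => groupCov Q g i j i' j')]

lemma continuous_Sigma : Continuous (Sigma Q) := by
  refine continuous_matrix fun q q' => ?_
  simp only [Sigma, Matrix.smul_apply, Matrix.sum_apply, SigmaBlock, Matrix.of_apply,
    smul_eq_mul]
  refine continuous_const.mul ?_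
  refine continuous_finsetSum _ fun l _ => ?_
  refine continuous_finsetSum _ fun l' _ => ?_
  have h : ∀ (b : Prop) [Decidable b] (g : Fin a) (y : ℝ),
      Continuous fun r : Fin a → ℝ => if b then r g * y else 0 := fun b _ g y => by
    by_cases hb : b
    · simp only [hb, if_true]
      fun_prop
    · simpa [hb] using continuous_const
  exact (((h _ _ _).sub (h _ _ _)).add (h _ _ _)).sub (h _ _ _)

variable [∀ i, IsProbabilityMeasure (Q i)]

/-- Identifies `Sigma` as the covariance of the projection; for nonnegative `r` the right side is
visibly nonnegative. -/
lemma dotProduct_Sigma_mulVec_eq_integral (r : Fin a → ℝ) (t : Fin a × Fin d → ℝ) :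
    t ⬝ᵥ (Sigma Q r).mulVec t = ∑ g, r g * ∫ x, score Q (projCoeff t g) g x ^ 2 ∂(Q g) := by
  simp_rw [dotProduct_Sigma_mulVec, integral_score_sq]

lemma groupCov_symm (l i : Fin a) (j : Fin d) (i' : Fin a) (j' : Fin d) :
    groupCov Q l i j i' j' = groupCov Q l i' j' i j := by
  rw [groupCov_eq_integral, groupCov_eq_integral]
  simp_rw [mul_comm]

lemma isHermitian_Sigma (r : Fin a → ℝ) : (Sigma Q r).IsHermitian := by
  ext q q'
  simp only [Matrix.conjTranspose_apply, star_trivial, Sigma, Matrix.smul_apply, Matrix.sum_apply,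
    SigmaBlock, Matrix.of_apply]
  -- Transposition is compensated by exchanging `l` and `l'`: the first and third terms are then
  -- symmetric, while the second and fourth change places.
  rw [Finset.sum_comm]
  congr 1
  refine Finset.sum_congr rfl fun l _ => Finset.sum_congr rfl fun l' _ => ?_
  have h₁ : (if l' = l then r l' * groupCov Q l' q'.1 q'.2 q.1 q.2 else 0) =
      if l = l' then r l * groupCov Q l q.1 q.2 q'.1 q'.2 else 0 := by
    by_cases h : l = l'
    · subst h; simp [groupCov_symm Q l q'.1]
    · simp [h, Ne.symm h]
  have h₂ : (if l' = q.1 then r l' * groupCov Q l' q'.1 q'.2 l q.2 else 0) =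
      if q.1 = l' then r q.1 * groupCov Q q.1 l q.2 q'.1 q'.2 else 0 := by
    by_cases h : l' = q.1
    · subst h; simp [groupCov_symm Q q.1 q'.1]
    · simp [h, Ne.symm h]
  have h₃ : (if q'.1 = q.1 then r q'.1 * groupCov Q q'.1 l' q'.2 l q.2 else 0) =
      if q.1 = q'.1 then r q.1 * groupCov Q q.1 l q.2 l' q'.2 else 0 := by
    by_cases h : q'.1 = q.1
    · rw [h]; simp [groupCov_symm Q q.1 l']
    · simp [h, Ne.symm h]
  have h₄ : (if q'.1 = l then r q'.1 * groupCov Q q'.1 l' q'.2 q.1 q.2 else 0) =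
      if l = q'.1 then r l * groupCov Q l q.1 q.2 l' q'.2 else 0 := by
    by_cases h : q'.1 = l
    · rw [h]; simp [groupCov_symm Q l l']
    · simp [h, Ne.symm h]
  rw [h₁, h₂, h₃, h₄]
  ring

lemma posSemidef_Sigma {r : Fin a → ℝ} (hr : ∀ i, 0 ≤ r i) : (Sigma Q r).PosSemidef := by
  refine Matrix.PosSemidef.of_dotProduct_mulVec_nonneg (isHermitian_Sigma Q r) fun t => ?_
  rw [star_trivial, dotProduct_Sigma_mulVec_eq_integral]
  exact Finset.sum_nonneg fun g _ =>
    mul_nonneg (hr g) (integral_nonneg fun x => sq_nonneg _)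

end Model

/-! ### Limits of powers of characteristic functions -/

/-- `(1 + g) ^ k → exp t` along any filter if `g → 0` and `k * g → t`. -/
lemma tendsto_one_add_pow_exp {ι : Type*} {l : Filter ι} {g : ι → ℂ} {k : ι → ℕ} {t : ℂ}
    (hg : Tendsto g l (𝓝 0)) (hkg : Tendsto (fun i => (k i : ℂ) * g i) l (𝓝 t)) :
    Tendsto (fun i => (1 + g i) ^ k i) l (𝓝 (Complex.exp t)) := by
  have hlog : (fun z : ℂ => Complex.log (1 + z) - z) =o[𝓝 0] fun z => z := by
    have h := (Complex.hasDerivAt_log (z := 1) (by simp)).isLittleO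
    simpa [Function.comp_def] using
      h.comp_tendsto (k := fun z : ℂ => 1 + z) (l' := 𝓝 0)
        (Continuous.tendsto' (by fun_prop) _ _ (by simp))
  -- Since `log (1 + z) - z = o(z)`, the error is `o(k * g)`, and `k * g` is bounded because it
  -- converges.
  have hsmall : Tendsto (fun i => (k i : ℂ) * (Complex.log (1 + g i) - g i)) l (𝓝 0) := by
    have h₁ : (fun i => (k i : ℂ) * (Complex.log (1 + g i) - g i)) =o[l]
        fun i => (k i : ℂ) * g i :=
      (Asymptotics.isBigO_refl (fun i => (k i : ℂ)) l).mul_isLittleO (hlog.comp_tendsto hg)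
    exact (Asymptotics.isLittleO_one_iff ℂ).1 (h₁.trans_isBigO (hkg.isBigO_one ℂ))
  have hlim : Tendsto (fun i => (k i : ℂ) * Complex.log (1 + g i)) l (𝓝 t) := by
    have := hsmall.add hkg
    rw [zero_add] at this
    exact this.congr fun i => by ring
  refine ((Complex.continuous_exp.tendsto t).comp hlim).congr' ?_
  filter_upwards [hg.eventually_ne (show (0 : ℂ) ≠ -1 by simp)] with i hi
  rw [Function.comp_apply, Complex.exp_nat_mul, Complex.exp_log]
  intro h
  exact hi (by linear_combination h)

/-- Powers of the characteristic function of a centered square-integrable variable, along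
arguments `u` with `k * u ^ 2 → s`. -/
lemma tendsto_charFun_pow {Ω : Type*} [MeasurableSpace Ω] {P : Measure Ω} [IsProbabilityMeasure P]
    {Y : Ω → ℝ} (hY : MemLp Y 2 P) (h0 : ∫ ω, Y ω ∂P = 0) {ι : Type*} {l : Filter ι} {u : ι → ℝ}
    {k : ι → ℕ} {s : ℝ} (hu : Tendsto u l (𝓝 0))
    (hku : Tendsto (fun i => (k i : ℝ) * u i ^ 2) l (𝓝 s)) :
    Tendsto (fun i => charFun (P.map Y) (u i) ^ k i) l
      (𝓝 (Complex.exp (-(s * (∫ ω, Y ω ^ 2 ∂P) / 2 : ℝ)))) := by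
  have hYm : AEMeasurable Y P := hY.aestronglyMeasurable.aemeasurable
  have hid : MemLp id 2 (P.map Y) :=
    (memLp_map_measure_iff (by fun_prop) hYm).2 (by simpa using hY)
  have : IsProbabilityMeasure (P.map Y) := Measure.isProbabilityMeasure_map hYm
  set v : ℝ := ∫ ω, Y ω ^ 2 ∂P with hv
  -- The linear Taylor term is absent because `Y` is centered. The law of `Y` is fixed, so a single
  -- expansion serves along the whole filter.
  have htaylor : (fun x : ℝ => charFun (P.map Y) x - (1 - (v : ℂ) * x ^ 2 / 2)) =o[𝓝 0]
      fun x => x ^ 2 := by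
    have h := taylor_isLittleO_univ (x₀ := 0) (contDiff_charFun (n := 2) (by exact_mod_cast hid))
    have h2 := taylorWithinEval_charFun_two_zero hYm hid
    simp only [h0, Pi.pow_apply, ← hv] at h2
    simp only [h2, sub_zero] at h
    refine h.congr_left fun x => ?_
    push_cast
    ring
  have hu' : (fun i => charFun (P.map Y) (u i) - (1 - (v : ℂ) * u i ^ 2 / 2)) =o[l]
      fun i => u i ^ 2 := htaylor.comp_tendsto hu
  have h1 : Tendsto (fun i => (k i : ℂ) * (charFun (P.map Y) (u i) - (1 - (v : ℂ) * u i ^ 2 / 2)))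
      l (𝓝 0) := by
    have h₁ : (fun i => (k i : ℂ) * (charFun (P.map Y) (u i) - (1 - (v : ℂ) * u i ^ 2 / 2))) =o[l]
        fun i => (k i : ℝ) * u i ^ 2 :=
      Asymptotics.IsBigO.mul_isLittleO
        (Asymptotics.IsBigO.of_norm_le (fun i => by simp)) hu'
    exact (Asymptotics.isLittleO_one_iff ℝ).1 (h₁.trans_isBigO (hku.isBigO_one ℝ))
  have h2 : Tendsto (fun i => (k i : ℂ) * (charFun (P.map Y) (u i) - 1)) l
      (𝓝 (-(s * v / 2 : ℝ))) := by
    have h3 : Tendsto (fun i => (((k i : ℝ) * u i ^ 2 : ℝ) : ℂ) * (-(v : ℂ) / 2)) l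
        (𝓝 ((s : ℂ) * (-(v : ℂ) / 2))) :=
      ((Complex.continuous_ofReal.tendsto s).comp hku).mul_const _
    have h4 := h1.add h3
    have e : (0 : ℂ) + (s : ℂ) * (-(v : ℂ) / 2) = -(s * v / 2 : ℝ) := by push_cast; ring
    rw [e] at h4
    exact h4.congr fun i => by push_cast; ring
  have hg : Tendsto (fun i => charFun (P.map Y) (u i) - 1) l (𝓝 0) := by
    have h := ((continuous_charFun (μ := P.map Y)).tendsto 0).comp hu
    simpa using h.sub_const 1
  simpa using tendsto_one_add_pow_exp hg h2

/-! ### Orthogonality for degenerate kernels -/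

section Degenerate

variable {Ω : Type*} [MeasurableSpace Ω] {P : Measure Ω} [IsProbabilityMeasure P]

lemma integral_eq_zero_of_indepFun {A B : Type*} [MeasurableSpace A] [MeasurableSpace B]
    {U : Ω → A} {W : Ω → B} (hU : AEMeasurable U P) (hW : AEMeasurable W P) (hUW : IndepFun U W P)
    {g : A × B → ℝ} (hg : Measurable g) {C : ℝ} (hC : ∀ z, |g z| ≤ C)
    (h0 : ∀ y, ∫ x, g (x, y) ∂(P.map U) = 0) : ∫ ω, g (U ω, W ω) ∂P = 0 := by
  have := Measure.isProbabilityMeasure_map hU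
  have := Measure.isProbabilityMeasure_map hW
  rw [← integral_map (hU.prodMk hW) hg.aestronglyMeasurable,
    (indepFun_iff_map_prod_eq_prod_map_map hU hW).1 hUW,
    integral_prod_symm _ (integrable_of_measurable_of_abs_le hg.aemeasurable hC)]
  simp [h0]

lemma integral_sq_sum_le_of_orthogonal {κ : Type*} (s : Finset κ) {H : κ → Ω → ℝ} {C : ℝ}
    (hH : ∀ x, AEMeasurable (H x) P) (hC : ∀ x ω, |H x ω| ≤ C)
    (horth : ∀ x ∈ s, ∀ y ∈ s, x ≠ y → ∫ ω, H x ω * H y ω ∂P = 0) :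
    ∫ ω, (∑ x ∈ s, H x ω) ^ 2 ∂P ≤ s.card * C ^ 2 := by
  have hle : ∀ x y ω, |H x ω * H y ω| ≤ C ^ 2 := fun x y ω => by
    rw [abs_mul, sq]
    exact mul_le_mul (hC x ω) (hC y ω) (abs_nonneg _) ((abs_nonneg _).trans (hC x ω))
  have hint : ∀ x y, Integrable (fun ω => H x ω * H y ω) P := fun x y =>
    integrable_of_measurable_of_abs_le ((hH x).mul (hH y)) (hle x y)
  simp_rw [sq (∑ x ∈ s, H x _), Finset.sum_mul_sum]
  rw [integral_finsetSum _ fun x _ => integrable_finsetSum _ fun y _ => hint x y, ← nsmul_eq_mul]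
  refine Finset.sum_le_card_nsmul _ _ _ fun x hx => ?_
  rw [integral_finsetSum _ fun y _ => hint x y,
    Finset.sum_eq_single_of_mem x hx fun y hy hyx => horth x hx y hy hyx.symm]
  calc ∫ ω, H x ω * H x ω ∂P ≤ ∫ _, C ^ 2 ∂P :=
        integral_mono (hint x x) (integrable_const _) fun ω => (le_abs_self _).trans (hle x x ω)
    _ = C ^ 2 := by simp

variable {ι E : Type*} [MeasurableSpace E] {X : ι → Ω → E}

/-- The index `i` occurs only once, so `X i` can be integrated out with the other variables fixed.
Those may coincide, hence the use of a finite set of indices. -/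
lemma integral_mul_eq_zero_of_degenerate [DecidableEq ι] (hX : ∀ i, AEMeasurable (X i) P)
    (hindep : iIndepFun X P) {h : E → E → ℝ} (hh : Measurable (Function.uncurry h)) {C : ℝ}
    (hC : ∀ x y, |h x y| ≤ C) {i i' k k' : ι} (hi : i ∉ ({i', k, k'} : Finset ι))
    (h0 : ∀ y, ∫ x, h x y ∂(P.map (X i)) = 0) :
    ∫ ω, h (X i ω) (X k ω) * h (X i' ω) (X k' ω) ∂P = 0 := by
  set T : Finset ι := {i', k, k'} with hT
  have hi' : i' ∈ T := by simp [hT]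
  have hk : k ∈ T := by simp [hT]
  have hk' : k' ∈ T := by simp [hT]
  have hind : IndepFun (X i) (fun ω (t : T) => X t ω) P :=
    (hindep.indepFun_finset₀ {i} T (by simpa using hi) hX).comp
      (φ := fun z : ({i} : Finset ι) → E => z ⟨i, Finset.mem_singleton_self i⟩) (ψ := id)
      (measurable_pi_apply _) measurable_id
  refine integral_eq_zero_of_indepFun (hX i) (aemeasurable_pi_lambda _ fun t : T => hX t) hind
    (g := fun z : E × (T → E) => h z.1 (z.2 ⟨k, hk⟩) * h (z.2 ⟨i', hi'⟩) (z.2 ⟨k', hk'⟩)) (C := C * C) ?_ ?_ ?_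
  · refine (hh.comp (f := fun z : E × (T → E) => (z.1, z.2 ⟨k, hk⟩)) (by fun_prop)).mul
      (hh.comp (f := fun z : E × (T → E) => (z.2 ⟨i', hi'⟩, z.2 ⟨k', hk'⟩)) (by fun_prop))
  · intro z
    rw [abs_mul]
    exact mul_le_mul (hC _ _) (hC _ _) (abs_nonneg _) ((abs_nonneg _).trans (hC z.1 z.1))
  · intro y
    simp only [integral_mul_const, h0, zero_mul]

/-- The second moment of a two-sample sum with a bounded doubly degenerate kernel. -/
lemma integral_sq_degenerate_sum_le (hX : ∀ i, AEMeasurable (X i) P)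
    (hindep : iIndepFun X P) {h : E → E → ℝ} (hh : Measurable (Function.uncurry h)) {C : ℝ}
    (hC : ∀ x y, |h x y| ≤ C) {e f : ℕ → ι} (he : e.Injective) (hf : f.Injective)
    (hef : ∀ k r, e k ≠ f r) (h₁ : ∀ k y, ∫ x, h x y ∂(P.map (X (e k))) = 0)
    (h₂ : ∀ r x, ∫ y, h x y ∂(P.map (X (f r))) = 0) (n m : ℕ) :
    ∫ ω, (∑ k ∈ Finset.range n, ∑ r ∈ Finset.range m, h (X (e k) ω) (X (f r) ω)) ^ 2 ∂P
      ≤ n * m * C ^ 2 := by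
  classical
  have hmeas : ∀ z : ℕ × ℕ, AEMeasurable (fun ω => h (X (e z.1) ω) (X (f z.2) ω)) P := fun z =>
    hh.comp_aemeasurable ((hX _).prodMk (hX _))
  have key := integral_sq_sum_le_of_orthogonal (P := P) (Finset.range n ×ˢ Finset.range m)
    (H := fun z ω => h (X (e z.1) ω) (X (f z.2) ω)) hmeas (fun z ω => hC _ _) ?_
  · simpa [Finset.sum_product] using key
  rintro ⟨k, r⟩ - ⟨k', r'⟩ - hne
  -- Two distinct pairs differ in a coordinate, and the variable at that coordinate occurs in one
  -- factor only. If only the second coordinates differ, the kernel is flipped so that this variable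
  -- becomes the first argument.
  by_cases hk : k = k'
  · have hr : r ≠ r' := fun hr => hne (by rw [hk, hr])
    refine integral_mul_eq_zero_of_degenerate hX hindep (h := fun x y => h y x)
      (hh.comp measurable_swap) (fun x y => hC y x) (i := f r) (i' := f r') (k := e k)
      (k' := e k') ?_ (h₂ r)
    simp [hf.eq_iff, hr, (hef _ _).symm]
  · refine integral_mul_eq_zero_of_degenerate hX hindep hh hC ?_ (h₁ k)
    simp [he.eq_iff, hk, hef]

end Degenerate

/-! ### Hájek projection of the estimated effects -/

section Sample

variable {a d : ℕ} (n : Fin a → ℕ) (x : Fin a → ℕ → Fin d → ℝ)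

/-- The estimated pairwise effect `∫ F̂_ℓj dF̂_ij`. -/
noncomputable def what (l i : Fin a) (j : Fin d) : ℝ :=
  (1 / (n i * n l : ℝ)) *
    ∑ k ∈ Finset.range (n i), ∑ r ∈ Finset.range (n l), c (x i k j - x l r j)

lemma phat_eq_sum (i : Fin a) (j : Fin d) :
    phat n x i j = (1 / (a : ℝ)) * ∑ l, what n x l i j := by
  unfold phat empMeasure
  -- For `n i = 0` the weight is `⊤`, whose `toReal` is `0`, and both sides vanish; no positivity is
  -- required.
  rw [integral_smul_measure,
    integral_finsetSum_measure fun k _ => integrable_dirac (by finiteness)]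
  simp only [integral_dirac, Ghat, Fhat, what, ENNReal.toReal_inv, ENNReal.toReal_natCast,
    smul_eq_mul, Finset.mul_sum]
  rw [Finset.sum_comm]
  refine Finset.sum_congr rfl fun l _ => Finset.sum_congr rfl fun k _ =>
    Finset.sum_congr rfl fun r _ => ?_
  rw [one_div_mul_eq_div, one_div_mul_eq_div, one_div_mul_eq_div, one_div_mul_eq_div,
    inv_mul_eq_div]
  field_simp

/-- Adding the double sum to itself with `k` and `r` exchanged makes every term equal to 1. -/
lemma what_self (i : Fin a) (j : Fin d) (hi : n i ≠ 0) : what n x i i j = 1 / 2 := by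
  have h : 2 * ∑ k ∈ Finset.range (n i), ∑ r ∈ Finset.range (n i), c (x i k j - x i r j) =
      (n i : ℝ) * n i := by
    rw [two_mul]
    nth_rw 2 [Finset.sum_comm]
    simp_rw [← Finset.sum_add_distrib]
    have : ∀ k r, c (x i k j - x i r j) + c (x i r j - x i k j) = 1 := fun k r => by
      rw [← neg_sub (x i k j), c_add_c_neg]
    simp [this]
  have hn : (n i : ℝ) ≠ 0 := by exact_mod_cast hi
  rw [what]
  field_simp
  linarith

variable (Q : Fin a → Measure (Fin d → ℝ))

/-- The mean over the sample of group `g` of the centered scores `F_ij(x_j)`. -/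
noncomputable def meanScore (g i : Fin a) (j : Fin d) : ℝ :=
  (1 / (n g : ℝ)) * ∑ k ∈ Finset.range (n g), (F Q i j (x g k j) - w Q i g j)

/-- The remainder in the projection of the estimated pairwise effect. -/
noncomputable def remainder (l i : Fin a) (j : Fin d) : ℝ :=
  what n x l i j - w Q l i j - meanScore n x Q i l j + meanScore n x Q l i j

/-- The kernel of the remainder. -/
noncomputable def degKernel (l i : Fin a) (j : Fin d) (y z : Fin d → ℝ) : ℝ :=
  c (y j - z j) - F Q l j (y j) + F Q i j (z j) - w Q i l j

lemma remainder_eq_sum (l i : Fin a) (j : Fin d) (hl : n l ≠ 0) (hi : n i ≠ 0) :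
    remainder n x Q l i j = (1 / (n i * n l : ℝ)) *
      ∑ k ∈ Finset.range (n i), ∑ r ∈ Finset.range (n l),
        degKernel Q l i j (x i k) (x l r) := by
  have hl' : (n l : ℝ) ≠ 0 := by exact_mod_cast hl
  have hi' : (n i : ℝ) ≠ 0 := by exact_mod_cast hi
  simp only [remainder, what, meanScore, degKernel, Finset.sum_add_distrib,
    Finset.sum_sub_distrib, Finset.sum_const, Finset.card_range, nsmul_eq_mul, ← Finset.mul_sum]
  field_simp
  ring

/-- Covers the pairs with `ℓ = i`, where the two samples are not independent and the orthogonality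
argument does not apply. -/
lemma remainder_self [∀ i, IsProbabilityMeasure (Q i)] (i : Fin a) (j : Fin d) (hi : n i ≠ 0) :
    remainder n x Q i i j = 0 := by
  rw [remainder, what_self n x i j hi]
  linarith [w_add_w Q i i j]

lemma sum_mul_phat_sub_p [∀ i, IsProbabilityMeasure (Q i)] (t : Fin a × Fin d → ℝ) :
    ∑ q, t q * (phat n x q.1 q.2 - p Q q.1 q.2) =
      ∑ g, ∑ k ∈ Finset.range (n g), (1 / (n g : ℝ)) * score Q (projCoeff t g) g (x g k) +
      ∑ q, ∑ l, (1 / (a : ℝ)) * t q * remainder n x Q l q.1 q.2 := by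
  have h₁ : ∀ q, t q * (phat n x q.1 q.2 - p Q q.1 q.2) =
      ∑ l, (1 / (a : ℝ)) * t q * (meanScore n x Q q.1 l q.2 - meanScore n x Q l q.1 q.2) +
      ∑ l, (1 / (a : ℝ)) * t q * remainder n x Q l q.1 q.2 := by
    intro q
    rw [phat_eq_sum, p_eq_sum, ← mul_sub, ← Finset.sum_sub_distrib, ← mul_assoc, Finset.mul_sum,
      ← Finset.sum_add_distrib]
    refine Finset.sum_congr rfl fun l _ => ?_
    rw [remainder]
    ring
  have h₂ : ∀ g, ∑ k ∈ Finset.range (n g), (1 / (n g : ℝ)) * score Q (projCoeff t g) g (x g k) =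
      ∑ q, projCoeff t g q * meanScore n x Q g q.1 q.2 := by
    intro g
    simp only [score, meanScore, Finset.mul_sum]
    rw [Finset.sum_comm]
    exact Finset.sum_congr rfl fun q _ => Finset.sum_congr rfl fun k _ => by ring
  simp_rw [h₁, h₂]
  rw [Finset.sum_add_distrib]
  congr 1
  -- Group `g` enters twice: as the group whose effect is estimated (`h₃`, weight `t (g, q.2)`) and
  -- as a reference group for the others (`h₄`, weight `-t q`). Together these form `projCoeff`.
  have h₃ : ∑ q : Fin a × Fin d, ∑ l, (1 / (a : ℝ)) * t q * meanScore n x Q q.1 l q.2 =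
      ∑ g, ∑ q : Fin a × Fin d, (1 / (a : ℝ)) * t (g, q.2) * meanScore n x Q g q.1 q.2 := by
    simp only [Fintype.sum_prod_type]
    exact Finset.sum_congr rfl fun i _ => Finset.sum_comm
  have h₄ : ∑ q : Fin a × Fin d, ∑ l, (1 / (a : ℝ)) * t q * meanScore n x Q l q.1 q.2 =
      ∑ g, ∑ q : Fin a × Fin d, (1 / (a : ℝ)) * t q * meanScore n x Q g q.1 q.2 :=
    Finset.sum_comm
  simp only [mul_sub, Finset.sum_sub_distrib]
  rw [h₃, h₄]
  simp only [← Finset.sum_sub_distrib]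
  refine Finset.sum_congr rfl fun g _ => Finset.sum_congr rfl fun q _ => ?_
  rw [projCoeff]
  ring

variable [∀ i, IsProbabilityMeasure (Q i)]

lemma measurable_degKernel (l i : Fin a) (j : Fin d) :
    Measurable (Function.uncurry (degKernel Q l i j)) := by
  unfold degKernel Function.uncurry
  fun_prop

lemma abs_degKernel_le (l i : Fin a) (j : Fin d) (y z : Fin d → ℝ) :
    |degKernel Q l i j y z| ≤ 4 := by
  have h₁ := abs_le.1 (abs_F_le_one Q l j (y j))
  have h₂ := abs_le.1 (abs_F_le_one Q i j (z j))
  have h₃ := abs_le.1 (abs_w_le_one Q i l j)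
  have h₄ := c_nonneg (y j - z j)
  have h₅ := c_le_one (y j - z j)
  rw [degKernel, abs_le]
  constructor <;> linarith

/-- Integrating `c` gives `1 - F Q i j (z j)`, which cancels the dependence on `z`; the constant
left over is `1 - w Q l i j - w Q i l j`. -/
lemma integral_degKernel_left (l i : Fin a) (j : Fin d) (z : Fin d → ℝ) :
    ∫ y, degKernel Q l i j y z ∂(Q i) = 0 := by
  have hc : Integrable (fun y : Fin d → ℝ => c (y j - z j)) (Q i) :=
    integrable_c_comp (Measurable.aemeasurable (by fun_prop))
  have hcF : Integrable (fun y : Fin d → ℝ => c (y j - z j) - F Q l j (y j)) (Q i) :=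
    hc.sub (integrable_F_comp Q i l j)
  have hcF' : Integrable (fun y : Fin d → ℝ => c (y j - z j) - F Q l j (y j) + F Q i j (z j))
    (Q i) := hcF.add (integrable_const _)
  unfold degKernel
  rw [integral_sub hcF' (integrable_const _), integral_add hcF (integrable_const _),
    integral_sub hc (integrable_F_comp Q i l j), ← w_eq_integral,
    ← integral_marginal Q i j (f := fun u => c (u - z j)) (by fun_prop), integral_c_sub_left, F]
  simp only [integral_const, probReal_univ, one_smul]
  linarith [w_add_w Q l i j]

lemma integral_degKernel_right (l i : Fin a) (j : Fin d) (y : Fin d → ℝ) :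
    ∫ z, degKernel Q l i j y z ∂(Q l) = 0 := by
  have hc : Integrable (fun z : Fin d → ℝ => c (y j - z j)) (Q l) :=
    integrable_c_comp (Measurable.aemeasurable (by fun_prop))
  have hcF : Integrable (fun z : Fin d → ℝ => c (y j - z j) - F Q l j (y j)) (Q l) :=
    hc.sub (integrable_const _)
  have hcF' : Integrable (fun z : Fin d → ℝ => c (y j - z j) - F Q l j (y j) + F Q i j (z j))
    (Q l) := hcF.add (integrable_F_comp Q l i j)
  unfold degKernel
  rw [integral_sub hcF' (integrable_const _), integral_add hcF (integrable_F_comp Q l i j),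
    integral_sub hc (integrable_const _), ← w_eq_integral,
    ← integral_marginal Q l j (f := fun u => c (y j - u)) (by fun_prop), integral_c_sub_right, F]
  simp

end Sample

/-! ### Passing from `L¹` closeness to characteristic functions -/

section Moments

variable {Ω : Type*} [MeasurableSpace Ω] {P : Measure Ω} [IsProbabilityMeasure P]

/-- The variance of `|Y|` is nonnegative. -/
lemma integral_abs_le_sqrt_integral_sq {Y : Ω → ℝ} (hY : MemLp Y 2 P) :
    ∫ ω, |Y ω| ∂P ≤ √(∫ ω, Y ω ^ 2 ∂P) := by
  have h := variance_eq_sub hY.abs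
  have h' := variance_nonneg (fun ω => |Y ω|) P
  apply Real.le_sqrt_of_sq_le
  simp only [Pi.abs_def, Pi.pow_apply, sq_abs] at h
  linarith

/-- Plays the role of Slutsky's lemma: `exp (i ·)` is 1-Lipschitz on the reals, so the two integrals
differ by at most the `L¹` distance. -/
lemma tendsto_integral_exp_of_tendsto_integral_abs_sub {S L : ℕ → Ω → ℝ}
    (hS : ∀ m, AEMeasurable (S m) P) (hL : ∀ m, AEMeasurable (L m) P)
    (hint : ∀ᶠ m in atTop, Integrable (fun ω => S m ω - L m ω) P)
    (hSL : Tendsto (fun m => ∫ ω, |S m ω - L m ω| ∂P) atTop (𝓝 0)) {z : ℂ}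
    (hz : Tendsto (fun m => ∫ ω, Complex.exp (L m ω * Complex.I) ∂P) atTop (𝓝 z)) :
    Tendsto (fun m => ∫ ω, Complex.exp (S m ω * Complex.I) ∂P) atTop (𝓝 z) := by
  have hexp : ∀ {Y : Ω → ℝ}, AEMeasurable Y P →
      Integrable (fun ω => Complex.exp (Y ω * Complex.I)) P := fun {Y} hY =>
    Integrable.of_bound (by fun_prop) 1 (ae_of_all _ fun ω => by
      rw [Complex.norm_exp_ofReal_mul_I])
  have hdiff : Tendsto (fun m => ∫ ω, Complex.exp (S m ω * Complex.I) ∂P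
      - ∫ ω, Complex.exp (L m ω * Complex.I) ∂P) atTop (𝓝 0) := by
    refine squeeze_zero_norm' ?_ hSL
    filter_upwards [hint] with m hm
    rw [← integral_sub (hexp (hS m)) (hexp (hL m))]
    refine norm_integral_le_of_norm_le hm.abs (ae_of_all _ fun ω => ?_)
    have e : Complex.exp (S m ω * Complex.I) - Complex.exp (L m ω * Complex.I) =
        Complex.exp (L m ω * Complex.I) *
          (Complex.exp (Complex.I * (S m ω - L m ω : ℝ)) - 1) := by
      rw [mul_sub, ← Complex.exp_add, mul_one]
      congr 2
      push_cast
      ring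
    rw [e, norm_mul, Complex.norm_exp_ofReal_mul_I, one_mul]
    exact Real.norm_exp_I_mul_ofReal_sub_one_le
  simpa using hdiff.add hz

end Moments

/-! ### Limit of the projection and negligibility of the remainder -/

section Limit

variable {a d : ℕ} {Ω : Type*} [MeasurableSpace Ω] {P : Measure Ω} {X : Fin a → ℕ → Ω → (Fin d → ℝ)}
  {Q : Fin a → Measure (Fin d → ℝ)}

lemma integral_exp_sum_score (hlaw : ∀ i k, HasLaw (X i k) (Q i) P)
    (hindep : iIndepFun (fun q : Fin a × ℕ => X q.1 q.2) P) (n : Fin a → ℕ)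
    {f : Fin a → (Fin d → ℝ) → ℝ} (hf : ∀ g, Measurable (f g)) (u : Fin a → ℝ) :
    ∫ ω, Complex.exp ((∑ g, ∑ k ∈ Finset.range (n g), u g * f g (X g k ω) : ℝ) * Complex.I) ∂P =
      ∏ g, charFun ((Q g).map (f g)) (u g) ^ n g := by
  have hX : ∀ q : (g : Fin a) × Fin (n g),
      AEMeasurable (fun ω => u q.1 * f q.1 (X q.1 q.2 ω)) P := fun q =>
    ((hf q.1).comp_aemeasurable (hlaw q.1 q.2).aemeasurable).const_mul _
  have hind : iIndepFun (fun (q : (g : Fin a) × Fin (n g)) ω => u q.1 * f q.1 (X q.1 q.2 ω)) P := by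
    have h := hindep.precomp (g := fun q : (g : Fin a) × Fin (n g) => (q.1, (q.2 : ℕ))) (by
      rintro ⟨g, k⟩ ⟨g', k'⟩ h
      simp only [Prod.mk.injEq] at h
      obtain ⟨rfl, h⟩ := h
      rw [Fin.ext h])
    exact h.comp (fun q y => u q.1 * f q.1 y) fun q => (hf q.1).const_mul _
  have key := congrFun (hind.charFun_map_fun_sum_eq_prod hX) 1
  rw [charFun_apply_real, integral_map (Finset.aemeasurable_fun_sum _ fun q _ => hX q)
    (by fun_prop)] at key
  simp only [Complex.ofReal_one, one_mul, Finset.prod_apply, Fintype.sum_sigma,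
    Fintype.prod_sigma] at key
  have hsum : ∀ ω g, ∑ k : Fin (n g), u g * f g (X g k ω) =
      ∑ k ∈ Finset.range (n g), u g * f g (X g k ω) := fun ω g =>
    Fin.sum_univ_eq_sum_range (fun k => u g * f g (X g k ω)) (n g)
  simp_rw [hsum] at key
  rw [key]
  refine Finset.prod_congr rfl fun g _ => ?_
  have hφ : ∀ k, charFun (P.map fun ω => u g * f g (X g k ω)) 1 =
      charFun ((Q g).map (f g)) (u g) := fun k => by
    rw [charFun_map_mul_comp (f := fun ω => f g (X g k ω))
        ((hf g).comp_aemeasurable (hlaw g k).aemeasurable), mul_one,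
      ← (hlaw g k).map_eq, AEMeasurable.map_map_of_aemeasurable (hf g).aemeasurable
        (hlaw g k).aemeasurable]
    rfl
  simp [hφ]

end Limit

section Limit

variable {a d : ℕ} {Ω : Type*} [MeasurableSpace Ω] {P : Measure Ω} {X : Fin a → ℕ → Ω → (Fin d → ℝ)}
  {Q : Fin a → Measure (Fin d → ℝ)}

lemma aemeasurable_phat (hX : ∀ i k, AEMeasurable (X i k) P) (n : Fin a → ℕ) (i : Fin a)
    (j : Fin d) : AEMeasurable (fun ω => phat n (fun i k => X i k ω) i j) P := by
  have hXj : ∀ i k, AEMeasurable (fun ω => X i k ω j) P := fun i k =>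
    (measurable_pi_apply j).comp_aemeasurable (hX i k)
  simp only [phat_eq_sum, what]
  refine (Finset.aemeasurable_fun_sum _ fun l _ => ?_).const_mul _
  refine (Finset.aemeasurable_fun_sum _ fun k _ => ?_).const_mul _
  exact Finset.aemeasurable_fun_sum _ fun r _ =>
    measurable_c.comp_aemeasurable ((hXj i k).sub (hXj l r))

variable [∀ i, IsProbabilityMeasure (Q i)]

lemma integral_abs_remainder_le [IsProbabilityMeasure P]
    (hlaw : ∀ i k, HasLaw (X i k) (Q i) P)
    (hindep : iIndepFun (fun q : Fin a × ℕ => X q.1 q.2) P) (n : Fin a → ℕ) (l i : Fin a)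
    (j : Fin d) (hl : n l ≠ 0) (hi : n i ≠ 0) :
    Integrable (fun ω => remainder n (fun i k => X i k ω) Q l i j) P ∧
      ∫ ω, |remainder n (fun i k => X i k ω) Q l i j| ∂P ≤ 4 / (√(n i) * √(n l)) := by
  have hX : ∀ i k, AEMeasurable (X i k) P := fun i k => (hlaw i k).aemeasurable
  by_cases hil : i = l
  · subst hil
    simp only [remainder_self n _ Q i j hi]
    exact ⟨integrable_zero _ _ _, by simp; positivity⟩
  simp only [remainder_eq_sum n _ Q l i j hl hi]
  set D : Ω → ℝ := fun ω => ∑ k ∈ Finset.range (n i), ∑ r ∈ Finset.range (n l),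
    degKernel Q l i j (X i k ω) (X l r ω) with hD
  have hDmem : MemLp D 2 P := by
    refine memLp_finsetSum _ fun k _ => memLp_finsetSum _ fun r _ => ?_
    exact MemLp.of_bound ((measurable_degKernel Q l i j).comp_aemeasurable
      ((hX i k).prodMk (hX l r))).aestronglyMeasurable 4
      (ae_of_all _ fun ω => abs_degKernel_le Q l i j _ _)
  have hDsq : ∫ ω, D ω ^ 2 ∂P ≤ n i * n l * 4 ^ 2 :=
    integral_sq_degenerate_sum_le (X := fun q : Fin a × ℕ => X q.1 q.2) (fun q => hX q.1 q.2)
      hindep (measurable_degKernel Q l i j) (abs_degKernel_le Q l i j)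
      (e := fun k => (i, k)) (f := fun r => (l, r)) (fun k k' h => (Prod.mk.inj h).2)
      (fun k k' h => (Prod.mk.inj h).2) (fun k r h => hil (Prod.mk.inj h).1)
      (fun k z => by rw [(hlaw i k).map_eq]; exact integral_degKernel_left Q l i j z)
      (fun r y => by rw [(hlaw l r).map_eq]; exact integral_degKernel_right Q l i j y) _ _
  refine ⟨(hDmem.integrable one_le_two).const_mul _, ?_⟩
  have hl' : (0 : ℝ) < n l := by exact_mod_cast Nat.pos_of_ne_zero hl
  have hi' : (0 : ℝ) < n i := by exact_mod_cast Nat.pos_of_ne_zero hi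
  have hDabs : ∫ ω, |D ω| ∂P ≤ √(n i) * √(n l) * 4 := by
    refine (integral_abs_le_sqrt_integral_sq hDmem).trans ((Real.sqrt_le_sqrt hDsq).trans_eq ?_)
    rw [Real.sqrt_mul (by positivity), Real.sqrt_mul hi'.le, Real.sqrt_sq (by norm_num)]
  simp_rw [abs_mul]
  rw [integral_const_mul, abs_of_pos (by positivity)]
  calc (1 / (n i * n l : ℝ)) * ∫ ω, |D ω| ∂P
      ≤ (1 / (n i * n l : ℝ)) * (√(n i) * √(n l) * 4) := by gcongr
    _ = 4 / (√(n i) * √(n l)) := by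
      have h₁ := Real.sq_sqrt hi'.le
      have h₂ := Real.sq_sqrt hl'.le
      have h₃ := (Real.sqrt_pos.2 hi').ne'
      have h₄ := (Real.sqrt_pos.2 hl').ne'
      have e : (n i * n l : ℝ) = √(n i) ^ 2 * √(n l) ^ 2 := by rw [h₁, h₂]
      rw [e]
      field_simp

variable {n : ℕ → Fin a → ℕ} {lam : Fin a → ℝ}

lemma tendsto_sampleSize (hN : Tendsto (fun m => total (n m)) atTop atTop)
    (hlam : ∀ i, lam i ∈ Set.Ioo (0 : ℝ) 1)
    (hn : ∀ i, Tendsto (fun m => (n m i : ℝ) / (total (n m) : ℝ)) atTop (𝓝 (lam i)))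
    (i : Fin a) : Tendsto (fun m => n m i) atTop atTop := by
  have hN' : Tendsto (fun m => (total (n m) : ℝ)) atTop atTop :=
    tendsto_natCast_atTop_atTop.comp hN
  refine (tendsto_natCast_atTop_iff (R := ℝ)).1 (((hn i).pos_mul_atTop (hlam i).1 hN').congr' ?_)
  filter_upwards [hN'.eventually_gt_atTop 0] with m hm
  exact div_mul_cancel₀ _ hm.ne'

lemma tendsto_total_div (hlam : ∀ i, lam i ∈ Set.Ioo (0 : ℝ) 1)
    (hn : ∀ i, Tendsto (fun m => (n m i : ℝ) / (total (n m) : ℝ)) atTop (𝓝 (lam i)))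
    (i : Fin a) : Tendsto (fun m => (total (n m) : ℝ) / (n m i : ℝ)) atTop (𝓝 (1 / lam i)) := by
  simpa using (hn i).inv₀ (hlam i).1.ne'

lemma tendsto_integral_abs_remainder [IsProbabilityMeasure P]
    (hlaw : ∀ i k, HasLaw (X i k) (Q i) P)
    (hindep : iIndepFun (fun q : Fin a × ℕ => X q.1 q.2) P)
    (hN : Tendsto (fun m => total (n m)) atTop atTop) (hlam : ∀ i, lam i ∈ Set.Ioo (0 : ℝ) 1)
    (hn : ∀ i, Tendsto (fun m => (n m i : ℝ) / (total (n m) : ℝ)) atTop (𝓝 (lam i)))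
    (l i : Fin a) (j : Fin d) :
    Tendsto (fun m => √(total (n m)) *
      ∫ ω, |remainder (n m) (fun i k => X i k ω) Q l i j| ∂P) atTop (𝓝 0) := by
  have hni := tendsto_sampleSize hN hlam hn i
  have hnl := tendsto_sampleSize hN hlam hn l
  -- This is `√N` times the bound `4 / (√n_i √n_ℓ)`: one root is absorbed by `N / n_i`, which stays
  -- bounded, and the other tends to infinity.
  have h₁ : Tendsto (fun m => 4 * √((total (n m) : ℝ) / (n m i : ℝ)) * (√(n m l : ℝ))⁻¹) atTop
      (𝓝 0) := by
    have h := ((tendsto_total_div hlam hn i).sqrt.const_mul 4).mul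
      (tendsto_inv_atTop_zero.comp
        (Real.tendsto_sqrt_atTop.comp (tendsto_natCast_atTop_atTop.comp hnl)))
    simpa using h
  refine squeeze_zero' (Eventually.of_forall fun m => by positivity) ?_ h₁
  filter_upwards [hni.eventually_ne_atTop 0, hnl.eventually_ne_atTop 0] with m hi hl
  calc √(total (n m)) * ∫ ω, |remainder (n m) (fun i k => X i k ω) Q l i j| ∂P
      ≤ √(total (n m)) * (4 / (√(n m i) * √(n m l))) := by
        gcongr
        exact (integral_abs_remainder_le hlaw hindep (n m) l i j hl hi).2
    _ = 4 * √((total (n m) : ℝ) / (n m i : ℝ)) * (√(n m l : ℝ))⁻¹ := by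
        rw [Real.sqrt_div (by positivity)]
        ring

/-- The characteristic function of the projection of the estimated effects converges. -/
lemma tendsto_integral_exp_projection (hlaw : ∀ i k, HasLaw (X i k) (Q i) P)
    (hindep : iIndepFun (fun q : Fin a × ℕ => X q.1 q.2) P)
    (hN : Tendsto (fun m => total (n m)) atTop atTop) (hlam : ∀ i, lam i ∈ Set.Ioo (0 : ℝ) 1)
    (hn : ∀ i, Tendsto (fun m => (n m i : ℝ) / (total (n m) : ℝ)) atTop (𝓝 (lam i)))
    (t : Fin a × Fin d → ℝ) :
    Tendsto (fun m => ∫ ω, Complex.exp ((∑ g, ∑ k ∈ Finset.range (n m g),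
      √(total (n m)) / n m g * score Q (projCoeff t g) g (X g k ω) : ℝ) * Complex.I) ∂P) atTop
      (𝓝 (Complex.exp (-(t ⬝ᵥ (Sigma Q fun i => 1 / lam i).mulVec t / 2 : ℝ)))) := by
  simp_rw [integral_exp_sum_score hlaw hindep _ (fun g => measurable_score Q (projCoeff t g) g)]
  have hlim : Complex.exp (-(t ⬝ᵥ (Sigma Q fun i => 1 / lam i).mulVec t / 2 : ℝ)) =
      ∏ g, Complex.exp
        (-(1 / lam g * (∫ x, score Q (projCoeff t g) g x ^ 2 ∂(Q g)) / 2 : ℝ)) := by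
    rw [← Complex.exp_sum, dotProduct_Sigma_mulVec_eq_integral, Finset.sum_div]
    push_cast
    rw [Finset.sum_neg_distrib]
  rw [hlim]
  refine tendsto_finsetProd _ fun g _ => ?_
  have hng := tendsto_sampleSize hN hlam hn g
  have hr := tendsto_total_div hlam hn g
  -- With `u = √N / n_g`, the quantity `n_g * u ^ 2` is `N / n_g`, so its limit `1 / lam g` is the
  -- variance factor of group `g`.
  have hsq : ∀ᶠ m in atTop, (total (n m) : ℝ) / n m g =
      (n m g : ℝ) * (√(total (n m)) / n m g) ^ 2 := by
    filter_upwards [hng.eventually_ne_atTop 0] with m hm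
    have : (n m g : ℝ) ≠ 0 := by exact_mod_cast hm
    rw [div_pow, Real.sq_sqrt (by positivity)]
    field_simp
  refine tendsto_charFun_pow ?_ (integral_score Q _ g) ?_ (hr.congr' hsq)
  · exact MemLp.of_bound (measurable_score Q _ g).aestronglyMeasurable _
      (ae_of_all _ fun x => abs_score_le Q _ g x)
  -- `u → 0` because `√N / n_g = √(N / n_g) / √n_g`.
  · have h := hr.sqrt.mul (tendsto_inv_atTop_zero.comp
      (Real.tendsto_sqrt_atTop.comp (tendsto_natCast_atTop_atTop.comp hng)))
    rw [mul_zero] at h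
    refine h.congr fun m => ?_
    rw [Real.sqrt_div (by positivity), Function.comp_apply, Function.comp_apply,
      Function.comp_apply, ← div_eq_mul_inv, div_div, Real.mul_self_sqrt (by positivity)]

lemma tendsto_integral_exp_phat [IsProbabilityMeasure P]
    (hlaw : ∀ i k, HasLaw (X i k) (Q i) P)
    (hindep : iIndepFun (fun q : Fin a × ℕ => X q.1 q.2) P)
    (hN : Tendsto (fun m => total (n m)) atTop atTop) (hlam : ∀ i, lam i ∈ Set.Ioo (0 : ℝ) 1)
    (hn : ∀ i, Tendsto (fun m => (n m i : ℝ) / (total (n m) : ℝ)) atTop (𝓝 (lam i)))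
    (t : Fin a × Fin d → ℝ) :
    Tendsto (fun m => ∫ ω, Complex.exp ((√(total (n m)) * ∑ q, t q *
      (phat (n m) (fun i k => X i k ω) q.1 q.2 - p Q q.1 q.2) : ℝ) * Complex.I) ∂P) atTop
      (𝓝 (Complex.exp (-(t ⬝ᵥ (Sigma Q fun i => 1 / lam i).mulVec t / 2 : ℝ)))) := by
  have hX : ∀ i k, AEMeasurable (X i k) P := fun i k => (hlaw i k).aemeasurable
  -- The gap between the statistic and its projection consists of remainders alone, so `L¹` bounds
  -- on these suffice.
  have hdiff : ∀ m ω, √(total (n m)) * ∑ q, t q *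
      (phat (n m) (fun i k => X i k ω) q.1 q.2 - p Q q.1 q.2) -
      ∑ g, ∑ k ∈ Finset.range (n m g),
        √(total (n m)) / n m g * score Q (projCoeff t g) g (X g k ω) =
      ∑ q, ∑ l, ((1 / (a : ℝ)) * t q) *
        (√(total (n m)) * remainder (n m) (fun i k => X i k ω) Q l q.1 q.2) := fun m ω => by
    rw [sum_mul_phat_sub_p, sub_eq_iff_eq_add, add_comm, mul_add]
    simp only [Finset.mul_sum]
    congr 1
    · exact Finset.sum_congr rfl fun g _ => Finset.sum_congr rfl fun k _ => by ring
    · exact Finset.sum_congr rfl fun q _ => Finset.sum_congr rfl fun l _ => by ring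
  have hev : ∀ᶠ m in atTop, ∀ i, n m i ≠ 0 :=
    eventually_all.2 fun i => (tendsto_sampleSize hN hlam hn i).eventually_ne_atTop 0
  have hint : ∀ m, (∀ i, n m i ≠ 0) → ∀ (q : Fin a × Fin d) (l : Fin a),
      Integrable (fun ω => ((1 / (a : ℝ)) * t q) *
        (√(total (n m)) * remainder (n m) (fun i k => X i k ω) Q l q.1 q.2)) P :=
    fun m hm q l => ((integral_abs_remainder_le hlaw hindep (n m) l q.1 q.2 (hm l)
      (hm q.1)).1.const_mul _).const_mul _
  refine tendsto_integral_exp_of_tendsto_integral_abs_sub (fun m => ?_) (fun m => ?_) ?_ ?_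
    (tendsto_integral_exp_projection hlaw hindep hN hlam hn t)
  · exact (Finset.aemeasurable_fun_sum _ fun q _ =>
      ((aemeasurable_phat hX _ _ _).sub_const _).const_mul _).const_mul _
  · exact Finset.aemeasurable_fun_sum _ fun g _ => Finset.aemeasurable_fun_sum _ fun k _ =>
      ((measurable_score Q _ g).comp_aemeasurable (hX g k)).const_mul _
  · filter_upwards [hev] with m hm
    simp_rw [hdiff]
    exact integrable_finsetSum _ fun q _ => integrable_finsetSum _ fun l _ => hint m hm q l
  · have hlim : Tendsto (fun m => ∑ q : Fin a × Fin d, ∑ l, |(1 / (a : ℝ)) * t q| *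
        (√(total (n m)) * ∫ ω, |remainder (n m) (fun i k => X i k ω) Q l q.1 q.2| ∂P)) atTop
        (𝓝 0) := by
      have h := tendsto_finsetSum (Finset.univ : Finset (Fin a × Fin d)) fun q _ =>
        tendsto_finsetSum (Finset.univ : Finset (Fin a)) fun l _ =>
          (tendsto_integral_abs_remainder hlaw hindep hN hlam hn l q.1 q.2).const_mul
            |(1 / (a : ℝ)) * t q|
      simpa using h
    refine squeeze_zero' (Eventually.of_forall fun m => by positivity) ?_ hlim
    filter_upwards [hev] with m hm
    simp_rw [hdiff]
    have habs : ∀ (q : Fin a × Fin d) (l : Fin a), ∫ ω, |((1 / (a : ℝ)) * t q) *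
        (√(total (n m)) * remainder (n m) (fun i k => X i k ω) Q l q.1 q.2)| ∂P =
        |(1 / (a : ℝ)) * t q| * (√(total (n m)) *
          ∫ ω, |remainder (n m) (fun i k => X i k ω) Q l q.1 q.2| ∂P) := fun q l => by
      simp_rw [abs_mul (1 / (a : ℝ) * t q), abs_mul √(total (n m) : ℝ),
        abs_of_nonneg (Real.sqrt_nonneg _)]
      rw [integral_const_mul, integral_const_mul]
    simp_rw [← habs]
    calc _ ≤ ∫ ω, ∑ q : Fin a × Fin d, ∑ l, |((1 / (a : ℝ)) * t q) *
          (√(total (n m)) * remainder (n m) (fun i k => X i k ω) Q l q.1 q.2)| ∂P := by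
          refine integral_mono (integrable_finsetSum _ fun q _ =>
            integrable_finsetSum _ fun l _ => hint m hm q l).abs
            (integrable_finsetSum _ fun q _ =>
              integrable_finsetSum _ fun l _ => (hint m hm q l).abs) fun ω => ?_
          exact (Finset.abs_sum_le_sum_abs _ _).trans
            (Finset.sum_le_sum fun q _ => Finset.abs_sum_le_sum_abs _ _)
      _ = _ := by
          rw [integral_finsetSum _ fun q _ =>
            integrable_finsetSum _ fun l _ => (hint m hm q l).abs]
          exact Finset.sum_congr rfl fun q _ =>
            integral_finsetSum _ fun l _ => (hint m hm q l).abs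

end Limit

end MannWhitney

theorem theorem1 {a d : ℕ} {Ω : Type*} [MeasurableSpace Ω] (P : Measure Ω)
    [IsProbabilityMeasure P]
    -- `X i k` is the observation vector of individual `k` in group `i`, with distribution `Q i`
    (X : Fin a → ℕ → Ω → (Fin d → ℝ)) (Q : Fin a → Measure (Fin d → ℝ))
    (hlaw : ∀ i k, HasLaw (X i k) (Q i) P)
    (hindep : iIndepFun (fun q : Fin a × ℕ => X q.1 q.2) P)
    -- the sample sizes `n m i` along a sequence of experiments with total sample size `N → ∞`
    (n : ℕ → Fin a → ℕ) (lam : Fin a → ℝ)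
    (hN : Tendsto (fun m => MannWhitney.total (n m)) atTop atTop)
    (hlam : ∀ i, lam i ∈ Set.Ioo (0 : ℝ) 1)
    (hn : ∀ i, Tendsto (fun m => (n m i : ℝ) / (MannWhitney.total (n m) : ℝ)) atTop
      (𝓝 (lam i))) :
    Tendsto (fun m => MannWhitney.Sigma Q
        (fun i => (MannWhitney.total (n m) : ℝ) / (n m i : ℝ))) atTop
      (𝓝 (MannWhitney.Sigma Q (fun i => 1 / lam i))) ∧
    (MannWhitney.Sigma Q (fun i => 1 / lam i)).PosSemidef ∧
    TendstoInDistribution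
      (fun (m : ℕ) (ω : Ω) =>
        (WithLp.toLp 2 (fun q : Fin a × Fin d =>
          Real.sqrt (MannWhitney.total (n m) : ℝ) *
            (MannWhitney.phat (n m) (fun i k => X i k ω) q.1 q.2
              - MannWhitney.p Q q.1 q.2)) : EuclideanSpace ℝ (Fin a × Fin d)))
      atTop (id : EuclideanSpace ℝ (Fin a × Fin d) → EuclideanSpace ℝ (Fin a × Fin d))
      (fun _ => P)
      (multivariateGaussian 0 (MannWhitney.Sigma Q (fun i => 1 / lam i))) := by
  have hQ : ∀ i, IsProbabilityMeasure (Q i) := fun i =>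
    (hlaw i 0).isProbabilityMeasure_iff.1 inferInstance
  have hX : ∀ i k, AEMeasurable (X i k) P := fun i k => (hlaw i k).aemeasurable
  have hpos := MannWhitney.posSemidef_Sigma Q (r := fun i => 1 / lam i)
    fun i => (one_div_pos.2 (hlam i).1).le
  refine ⟨((MannWhitney.continuous_Sigma Q).tendsto _).comp (tendsto_pi_nhds.2
    fun i => MannWhitney.tendsto_total_div hlam hn i), hpos, ?_⟩
  have hmeas : ∀ m, AEMeasurable (fun ω => (WithLp.toLp 2 (fun q : Fin a × Fin d =>
      Real.sqrt (MannWhitney.total (n m) : ℝ) *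
        (MannWhitney.phat (n m) (fun i k => X i k ω) q.1 q.2
          - MannWhitney.p Q q.1 q.2)) : EuclideanSpace ℝ (Fin a × Fin d))) P := fun m =>
    (WithLp.measurable_toLp 2 _).comp_aemeasurable (aemeasurable_pi_lambda _ fun q =>
      ((MannWhitney.aemeasurable_phat hX (n m) q.1 q.2).sub_const _).const_mul _)
  refine ⟨hmeas, by fun_prop, ?_⟩
  -- Lévy's continuity theorem: the characteristic function at `t` is the scalar limit already
  -- obtained in the direction `t`.
  refine ProbabilityMeasure.tendsto_iff_tendsto_charFun.2 fun t => ?_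
  simp only [ProbabilityMeasure.coe_mk, Measure.map_id]
  rw [charFun_multivariateGaussian hpos]
  have hlim := MannWhitney.tendsto_integral_exp_phat hlaw hindep hN hlam hn (WithLp.ofLp t)
  convert hlim using 2 with m
  · rw [charFun_apply, integral_map (hmeas m) (by fun_prop)]
    congr 1
    funext ω
    rw [PiLp.inner_apply, Finset.mul_sum]
    congr 3
    refine Finset.sum_congr rfl fun q _ => ?_
    simp
    ring
  · simp
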